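/- Let $\Omega\subset\mathbb R^2$ be a bounded polygonal domain with Lipschitz boundary, and let $\Omega^-$ be a domain with $\overline{\Omega^-}\subset\Omega$ whose boundary $\Gamma=\partial\Omega^-$ (the interface) is of class $C^2$ and such that $\Omega^+=\Omega\setminus\overline{\Omega^-}$ is a domain. Let $\beta=\beta^\pm$ on $\Omega^\pm$ with constants $\beta^-,\beta^+>0$, let $f,y_d\in L^2(\Omega)$ and $\alpha>0$. Here $L^2(\Gamma)$ is taken with respect to arc length, and $H^1_0(\Omega)$ is the closure of $C_c^\infty(\Omega)$ in the $H^1$ norm. For $y,v\in H_0^1(\Omega)$ and $u\in L^2(\Gamma)$ put $$a(y,v)=\int_{\Omega^-}\beta^-\nabla y\cdot\nabla v\,dx+\int_{\Omega^+}\beta^+\nabla y\cdot\nabla v\,dx,\qquad (f,v)=\int_\Omega fv\,dx,\qquad \langle u,v\rangle=\int_\Gamma uv\,d\Gamma,$$ where in the last integral $v$ stands for its trace on $\Gamma$. The weak state equation for the control $u$ is: $y\in H_0^1(\Omega)$ and $$a(y,v)=(f,v)+\langle u,v\rangle\qquad\text{for all }v\in H^1_0(\Omega).\tag{1}$$ Then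 the restriction $\varphi\mapsto\varphi|_\Gamma$ of functions $\varphi\in C_c^\infty(\Omega)$ has a unique continuous linear extension $H_0^1(\Omega)\to L^2(\Gamma)$ (the trace), and for every $u\in L^2(\Gamma)$ equation (1) has a unique solution $y=Su\in H^1_0(\Omega)$. For every non-empty, convex and closed set $U_{ad}\subset L^2(\Gamma)$ the problem $$\min\ J(y,u)=\tfrac12\int_\Omega (y-y_d)^2\,dx+\tfrac{\alpha}{2}\int_\Gamma u^2\,d\Gamma\quad\text{over all }(y,u)\in H_0^1(\Omega)\times U_{ad}\text{ satisfying (1)}$$ has a unique solution $(y^*,u^*)\in H^1_0(\Omega)\times L^2(\Gamma)$. A pair $(y^*,u^*)$ solves this problem if and only if $u^*\in U_{ad}$, $y^*=Su^*$ and $\widehat J(u^*)\le\widehat J(u)$ for all $u\in U_{ad}$, where $$\widehat J(u)=\tfrac12\|Su-y_d\|_{L^2(\Omega)}^2+\tfrac{\alpha}{2}\|u\|_{L^2(\Gamma)}^2 .$$ Moreover, for all real numbers $u_a<u_b$ the set $\{u\in L^2(\Gamma): u_a\le u\le u_b\text{ a.e. on }\Gamma\}$ is non-empty, convex and closed, so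 that the above applies to it. -/

import Mathlib

open Set MeasureTheory TopologicalSpace
open scoped ENNReal Distributions InnerProductSpace Gradient

noncomputable section

namespace InterfaceControl

/-- The Euclidean plane. -/
abbrev Plane : Type := EuclideanSpace ℝ (Fin 2)

/-! ### Geometry -/

/-- Near each of its boundary points `x`, in suitable orthonormal coordinates `z` centred at `x`,
the set `D` is the strict subgraph `z 1 < ψ (z 0)` of a function `ψ` of regularity `P`. -/
def HasGraphBoundary (P : (ℝ → ℝ) → Prop) (D : Set Plane) : Prop :=
  ∀ x ∈ frontier D, ∃ (e : Plane ≃ₗᵢ[ℝ] Plane) (r h : ℝ) (ψ : ℝ → ℝ),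
    0 < r ∧ 0 < h ∧ P ψ ∧
      ∀ z : Plane, |z 0| < r → |z 1| < h → (x + e z ∈ D ↔ z 1 < ψ (z 0))

/-- `D` has a Lipschitz boundary. -/
def HasLipschitzBoundary (D : Set Plane) : Prop :=
  HasGraphBoundary (fun ψ => ∃ K, LipschitzWith K ψ) D

/-- `D` has a boundary of class `C²`. -/
def HasC2Boundary (D : Set Plane) : Prop :=
  HasGraphBoundary (fun ψ => ContDiff ℝ 2 ψ) D

/-- The boundary of `D` is a finite union of line segments. -/
def HasPolygonalBoundary (D : Set Plane) : Prop :=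
  ∃ s : Finset (Plane × Plane), frontier D = ⋃ p ∈ s, segment ℝ p.1 p.2

/-- The interface `Γ = ∂Ω⁻`. -/
def interface (Ωm : Opens Plane) : Set Plane := frontier (Ωm : Set Plane)

/-- The outer subdomain `Ω⁺ = Ω \ (Ω⁻ ∪ Γ)`. -/
def outer (Ω Ωm : Opens Plane) : Set Plane := (Ω : Set Plane) \ closure (Ωm : Set Plane)

/-- `Ω` is a bounded polygonal domain with Lipschitz boundary, and the closed `C²` interface
`Γ = ∂Ω⁻` separates it into the subdomains `Ω⁻` and `Ω⁺`, with `Ω⁻` strictly inside `Ω`. -/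
structure IsInterfaceGeometry (Ω Ωm : Opens Plane) : Prop where
  isBounded : Bornology.IsBounded (Ω : Set Plane)
  isConnected : IsConnected (Ω : Set Plane)
  polygonal : HasPolygonalBoundary (Ω : Set Plane)
  lipschitz : HasLipschitzBoundary (Ω : Set Plane)
  isConnected_inner : IsConnected (Ωm : Set Plane)
  isConnected_outer : IsConnected (outer Ω Ωm)
  closure_inner_subset : closure (Ωm : Set Plane) ⊆ Ω
  interface_C2 : HasC2Boundary (Ωm : Set Plane)

/-! ### The spaces `L²(Ω)`, `L²(Γ)` and `H¹₀(Ω)` -/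

/-- Lebesgue measure on `Ω`. -/
abbrev volOn (Ω : Opens Plane) : Measure Plane := volume.restrict (Ω : Set Plane)

/-- Arc length on `Γ` (one-dimensional Hausdorff measure). -/
abbrev arcLength (Ωm : Opens Plane) : Measure Plane :=
  (Measure.hausdorffMeasure 1).restrict (interface Ωm)

/-- `L²(Ω)`. -/
abbrev L2 (Ω : Opens Plane) : Type := Lp ℝ 2 (volOn Ω)

/-- `L²(Ω; ℝ²)`. -/
abbrev L2Vec (Ω : Opens Plane) : Type := Lp Plane 2 (volOn Ω)

/-- `L²(Γ)`. -/
abbrev L2Interface (Ωm : Opens Plane) : Type := Lp ℝ 2 (arcLength Ωm)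

/-- The Hilbert space of pairs `(y, g) ∈ L²(Ω) × L²(Ω; ℝ²)` with norm
`(‖y‖² + ‖g‖²)^{1/2}`; on pairs `(y, ∇y)` this is the `H¹(Ω)` norm of `y`. -/
abbrev L2Pair (Ω : Opens Plane) : Type := WithLp 2 (L2 Ω × L2Vec Ω)

theorem memLp_test {Ω : Opens Plane} (φ : 𝓓(Ω, ℝ)) : MemLp φ 2 (volOn Ω) :=
  (φ.continuous.memLp_of_hasCompactSupport φ.hasCompactSupport).restrict _

theorem memLp_gradient_test {Ω : Opens Plane} (φ : 𝓓(Ω, ℝ)) : MemLp (∇ φ) 2 (volOn Ω) := by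
  have hd : Continuous (fderiv ℝ φ) := φ.contDiff.continuous_fderiv (by simp)
  have hc : Continuous (∇ φ) := (InnerProductSpace.toDual ℝ Plane).symm.continuous.comp hd
  have hs : HasCompactSupport (∇ φ) :=
    (φ.hasCompactSupport.fderiv ℝ).comp_left (g := (InnerProductSpace.toDual ℝ Plane).symm)
      (map_zero _)
  exact (hc.memLp_of_hasCompactSupport hs).restrict _

/-- The pair `(φ, ∇φ)` of a test function `φ ∈ C_c^∞(Ω)`. -/
def testPair {Ω : Opens Plane} (φ : 𝓓(Ω, ℝ)) : L2Pair Ω :=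
  WithLp.toLp 2 ((memLp_test φ).toLp φ, (memLp_gradient_test φ).toLp (∇ φ))

/-- `H¹₀(Ω)`: the closure of `C_c^∞(Ω)` in the `H¹` norm, a function being recorded together with
its weak gradient (see `isWeakGradient_of_mem_H10`). -/
def H10 (Ω : Opens Plane) : Submodule ℝ (L2Pair Ω) :=
  (Submodule.span ℝ (range (testPair (Ω := Ω)))).topologicalClosure

theorem testPair_mem_H10 {Ω : Opens Plane} (φ : 𝓓(Ω, ℝ)) : testPair φ ∈ H10 Ω :=
  Submodule.le_topologicalClosure _ (Submodule.subset_span ⟨φ, rfl⟩)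

/-- A test function as an element of `H¹₀(Ω)`. -/
def ofTest {Ω : Opens Plane} (φ : 𝓓(Ω, ℝ)) : H10 Ω := ⟨testPair φ, testPair_mem_H10 φ⟩

/-- The function underlying an element of `H¹₀(Ω)`. -/
def H10.val {Ω : Opens Plane} (y : H10 Ω) : L2 Ω := (y : L2Pair Ω).fst

/-- The weak gradient of an element of `H¹₀(Ω)`. -/
def H10.grad {Ω : Opens Plane} (y : H10 Ω) : L2Vec Ω := (y : L2Pair Ω).snd

/-- `g` is the weak gradient of `y` on `Ω`. -/
def IsWeakGradient {Ω : Opens Plane} (y : L2 Ω) (g : L2Vec Ω) : Prop :=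
  ∀ (φ : 𝓓(Ω, ℝ)) (w : Plane),
    ∫ x in (Ω : Set Plane), y x * fderiv ℝ φ x w = -∫ x in (Ω : Set Plane), ⟪g x, w⟫_ℝ * φ x

/-- The second component of an element of `H¹₀(Ω)` is the weak gradient of the first one. -/
theorem isWeakGradient_of_mem_H10 {Ω : Opens Plane} (y : H10 Ω) :
    IsWeakGradient (H10.val y) (H10.grad y) := by
  intro φ w
  have hd : Continuous (fderiv ℝ φ) := φ.contDiff.continuous_fderiv (by simp)
  have hdw : Continuous (fun x => fderiv ℝ φ x w) := hd.clm_apply continuous_const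
  have hsw : HasCompactSupport (fun x => fderiv ℝ φ x w) := φ.hasCompactSupport.fderiv_apply ℝ w
  have h1 : MemLp (fun x => fderiv ℝ φ x w) 2 (volOn Ω) :=
    (hdw.memLp_of_hasCompactSupport hsw).restrict _
  have hcs : HasCompactSupport (fun x => φ x • w) := φ.hasCompactSupport.smul_right
  have h2 : MemLp (fun x => φ x • w) 2 (volOn Ω) :=
    ((φ.continuous.smul continuous_const).memLp_of_hasCompactSupport hcs).restrict _
  let q : L2Pair Ω := WithLp.toLp 2 (h1.toLp _, h2.toLp _)
  have key : ∀ p : L2Pair Ω, ⟪q, p⟫_ℝ =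
      (∫ x in (Ω : Set Plane), p.fst x * fderiv ℝ φ x w)
        + ∫ x in (Ω : Set Plane), ⟪p.snd x, w⟫_ℝ * φ x := by
    intro p
    rw [WithLp.prod_inner_apply, L2.inner_def, L2.inner_def]
    congr 1
    · refine integral_congr_ae ?_
      filter_upwards [h1.coeFn_toLp] with x hx
      have : (q.fst : Plane → ℝ) x = fderiv ℝ φ x w := hx
      simp [q, hx]
    · refine integral_congr_ae ?_
      filter_upwards [h2.coeFn_toLp] with x hx
      simp [q, hx, inner_smul_left, real_inner_comm, mul_comm]
  have hspan : Submodule.span ℝ (range (testPair (Ω := Ω)))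
      ≤ LinearMap.ker (innerSL ℝ q).toLinearMap := by
    rw [Submodule.span_le]
    rintro _ ⟨η, rfl⟩
    change ⟪q, testPair η⟫_ℝ = 0
    rw [key]
    have hη : ContDiff ℝ 1 η := η.contDiff.of_le (by simp)
    have hφ : ContDiff ℝ 1 φ := φ.contDiff.of_le (by simp)
    have e1 : ∫ x in (Ω : Set Plane), (testPair η).fst x * fderiv ℝ φ x w
        = ∫ x, η x * fderiv ℝ φ x w := by
      rw [← setIntegral_eq_integral_of_forall_compl_eq_zero (s := (Ω : Set Plane))
        (f := fun x => η x * fderiv ℝ φ x w)]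
      · refine integral_congr_ae ?_
        filter_upwards [(memLp_test η).coeFn_toLp] with x hx
        simp [testPair, hx]
      · intro x hx
        rw [image_eq_zero_of_notMem_tsupport (fun h => hx (η.tsupport_subset h)), zero_mul]
    have e2 : ∫ x in (Ω : Set Plane), ⟪(testPair η).snd x, w⟫_ℝ * φ x
        = ∫ x, fderiv ℝ η x w * φ x := by
      rw [← setIntegral_eq_integral_of_forall_compl_eq_zero (s := (Ω : Set Plane))
        (f := fun x => fderiv ℝ η x w * φ x)]
      · refine integral_congr_ae ?_
        filter_upwards [(memLp_gradient_test η).coeFn_toLp] with x hx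
        simp [testPair, hx, gradient]
      · intro x hx
        rw [image_eq_zero_of_notMem_tsupport (fun h => hx (φ.tsupport_subset h)), mul_zero]
    have hηd : Continuous (fun x => fderiv ℝ η x w) :=
      (η.contDiff.continuous_fderiv (by simp)).clm_apply continuous_const
    rw [e1, e2, integral_mul_fderiv_eq_neg_fderiv_mul_of_integrable, neg_add_cancel]
    · exact (hηd.mul φ.continuous).integrable_of_hasCompactSupport φ.hasCompactSupport.mul_left
    · exact (η.continuous.mul hdw).integrable_of_hasCompactSupport hsw.mul_left
    · exact (η.continuous.mul φ.continuous).integrable_of_hasCompactSupport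
        φ.hasCompactSupport.mul_left
    · exact fun x _ => hη.differentiable (by simp) x
    · exact fun x _ => hφ.differentiable (by simp) x
  have hcl := Submodule.topologicalClosure_minimal _ hspan (innerSL ℝ q).isClosed_ker
  have h0 : ⟪q, (y : L2Pair Ω)⟫_ℝ = 0 := hcl y.2
  rw [key] at h0
  exact eq_neg_of_add_eq_zero_left h0

/-- `T` is the trace operator `H¹₀(Ω) → L²(Γ)`: the continuous linear extension of the restriction
`φ ↦ φ|_Γ` of test functions. -/
def IsTraceOperator {Ω Ωm : Opens Plane} (T : H10 Ω →L[ℝ] L2Interface Ωm) : Prop :=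
  ∀ φ : 𝓓(Ω, ℝ), ∀ᵐ x ∂(arcLength Ωm), T (ofTest φ) x = φ x

/-! ### The state equation and the optimal control problem -/

/-- The bilinear form `a(y,v) = ∑_{s = ±} ∫_{Ω^s} β^s ∇y · ∇v dx`. -/
def bilin {Ω : Opens Plane} (Ωm : Opens Plane) (βm βp : ℝ) (y v : H10 Ω) : ℝ :=
  (∫ x in (Ωm : Set Plane), βm * ⟪H10.grad y x, H10.grad v x⟫_ℝ)
    + ∫ x in outer Ω Ωm, βp * ⟪H10.grad y x, H10.grad v x⟫_ℝ

/-- `y ∈ H¹₀(Ω)` is the weak solution of the interface problem with flux jump `u`: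
`a(y,v) = (f,v) + ⟨u,v⟩` for all `v ∈ H¹₀(Ω)`, where `⟨u,v⟩ = ∫_Γ u v dΓ`. -/
def IsWeakState {Ω Ωm : Opens Plane} (T : H10 Ω →L[ℝ] L2Interface Ωm) (βm βp : ℝ) (f : L2 Ω)
    (u : L2Interface Ωm) (y : H10 Ω) : Prop :=
  ∀ v : H10 Ω, bilin Ωm βm βp y v =
    (∫ x in (Ω : Set Plane), f x * H10.val v x) + ∫ x, u x * T v x ∂(arcLength Ωm)

/-- `S` is the control-to-state operator. -/
def IsSolutionOperator {Ω Ωm : Opens Plane} (T : H10 Ω →L[ℝ] L2Interface Ωm) (βm βp : ℝ)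
    (f : L2 Ω) (S : L2Interface Ωm → H10 Ω) : Prop :=
  ∀ u, IsWeakState T βm βp f u (S u)

/-- The cost functional `J(y,u) = ½ ∫_Ω (y - y_d)² dx + (α/2) ∫_Γ u² dΓ`. -/
def cost {Ω Ωm : Opens Plane} (α : ℝ) (yd : L2 Ω) (y : H10 Ω) (u : L2Interface Ωm) : ℝ :=
  1 / 2 * (∫ x in (Ω : Set Plane), (H10.val y x - yd x) ^ 2)
    + α / 2 * ∫ x, u x ^ 2 ∂(arcLength Ωm)

/-- The reduced cost functional `Ĵ(u) = ½ ‖Su - y_d‖²_{L²(Ω)} + (α/2) ‖u‖²_{L²(Γ)}`. -/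
def reducedCost {Ω Ωm : Opens Plane} (S : L2Interface Ωm → H10 Ω) (α : ℝ) (yd : L2 Ω)
    (u : L2Interface Ωm) : ℝ :=
  1 / 2 * ‖H10.val (S u) - yd‖ ^ 2 + α / 2 * ‖u‖ ^ 2

/-- `(y, u)` minimizes `J` among all pairs in `H¹₀(Ω) × U` that satisfy the weak state equation. -/
def IsOptimalPair {Ω Ωm : Opens Plane} (T : H10 Ω →L[ℝ] L2Interface Ωm) (βm βp : ℝ) (f : L2 Ω)
    (α : ℝ) (yd : L2 Ω) (U : Set (L2Interface Ωm)) (p : H10 Ω × L2Interface Ωm) : Prop :=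
  p.2 ∈ U ∧ IsWeakState T βm βp f p.2 p.1 ∧
    ∀ (y : H10 Ω) (u : L2Interface Ωm), u ∈ U → IsWeakState T βm βp f u y →
      cost α yd p.1 p.2 ≤ cost α yd y u

/-- `u` solves the reduced problem over `U` and `y = Su` is the associated state. -/
def IsReducedSolution {Ω Ωm : Opens Plane} (S : L2Interface Ωm → H10 Ω) (α : ℝ) (yd : L2 Ω)
    (U : Set (L2Interface Ωm)) (p : H10 Ω × L2Interface Ωm) : Prop :=
  p.2 ∈ U ∧ p.1 = S p.2 ∧ ∀ u ∈ U, reducedCost S α yd p.2 ≤ reducedCost S α yd u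

/-- The box `{u ∈ L²(Γ) : u_a ≤ u ≤ u_b a.e. on Γ}`. -/
def boxControls (Ωm : Opens Plane) (ua ub : ℝ) : Set (L2Interface Ωm) :=
  {u | ∀ᵐ x ∂(arcLength Ωm), ua ≤ u x ∧ u x ≤ ub}

end InterfaceControl

end

noncomputable section

namespace InterfaceControl

open scoped NNReal Topology
open Filter

/-! ### The trace inequality -/

/-! Everything rests on two estimates for test functions. The first is the trace inequality
`hasTraceBound_frontier`: near a boundary point, `Γ` is a `C²` graph, and on each line transversal
to it the value of `φ²` on `Γ` is controlled by the integral of `φ² + |∇φ|²` along that line;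
integrating over the lines and covering the compact set `Γ` by finitely many charts gives the bound.
By density the restriction to `Γ` extends uniquely. The same argument shows that `Γ` has finite
length, hence zero area. The second is Poincaré's inequality. As `Γ` is null, `Ω⁻` and `Ω⁺` together
carry the whole gradient, so the form is coercive (`isCoercive_bilinL`) and Lax–Milgram makes the
state an affine continuous function of `u` (`isWeakState_iff`). The reduced cost is then `½‖Au + b‖²
+ (α/2)‖u‖²`, half the squared distance from a point to the image of `u` under `(A, √α)`. This map
is bounded below, so the projection onto a closed convex set yields a unique minimizer
(`existsUnique_forall_tikhonov_le`). -/

theorem enorm_sq_le_lintegral_deriv {g : ℝ → ℝ} (hg : ContDiff ℝ 1 g) (hs : HasCompactSupport g)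
    (a : ℝ) : ‖g a‖ₑ ^ 2 ≤ ∫⁻ t, (‖g t‖ₑ ^ 2 + ‖deriv g t‖ₑ ^ 2) := by
  have hs2 : HasCompactSupport (fun t => g t ^ 2) :=
    hs.comp_left (g := fun y : ℝ => y ^ 2) (by simp)
  -- Integrate `(g²)' = 2gg'` over a half-line ending at `a`, then use `2|gg'| ≤ g² + g'²`.
  have h := hs2.enorm_le_lintegral_Ici_deriv (hg.pow 2) a
  rw [enorm_pow] at h
  refine h.trans ((setLIntegral_le_lintegral _ _).trans (lintegral_mono fun t => ?_))
  have hd : deriv (fun t => g t ^ 2) t = 2 * g t * deriv g t := by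
    have := ((hg.differentiable one_ne_zero t).hasDerivAt.pow 2).deriv
    simpa only [Nat.cast_ofNat, Nat.add_one_sub_one, pow_one] using! this
  rw [hd]
  simp only [Real.enorm_eq_ofReal_abs]
  rw [← ENNReal.ofReal_pow (abs_nonneg _), ← ENNReal.ofReal_pow (abs_nonneg _),
    ← ENNReal.ofReal_add (by positivity) (by positivity)]
  refine ENNReal.ofReal_le_ofReal ?_
  rw [abs_mul, abs_mul, abs_two]
  nlinarith [sq_nonneg (|g t| - |deriv g t|)]

/-- The point with coordinates `(t, s)` in the orthonormal frame `e` centred at `x`. -/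
def framePoint (x : Plane) (e : Plane ≃ₗᵢ[ℝ] Plane) (t s : ℝ) : Plane := x + e !₂[t, s]

theorem framePoint_apply (x : Plane) (e : Plane ≃ₗᵢ[ℝ] Plane) (z : Plane) :
    framePoint x e (z 0) (z 1) = x + e z := by
  have : !₂[z 0, z 1] = z := by
    ext i
    fin_cases i <;> rfl
  rw [framePoint, this]

theorem framePoint_eq (x : Plane) (e : Plane ≃ₗᵢ[ℝ] Plane) (t s : ℝ) :
    framePoint x e t s = (x + t • e !₂[1, 0]) + s • e !₂[0, 1] := by
  have : (!₂[t, s] : Plane) = t • !₂[1, 0] + s • !₂[0, 1] := by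
    ext i
    fin_cases i <;> simp
  rw [framePoint, this, map_add, map_smul, map_smul, add_assoc]

/-- Tonelli in rotated coordinates: a rigid motion preserves area. -/
theorem lintegral_framePoint (x : Plane) (e : Plane ≃ₗᵢ[ℝ] Plane) {F : Plane → ℝ≥0∞}
    (hF : Measurable F) : ∫⁻ y, F y = ∫⁻ t, ∫⁻ s, F (framePoint x e t s) := by
  have h1 : MeasurePreserving (fun p : ℝ × ℝ => x + e (WithLp.toLp 2
      (MeasurableEquiv.finTwoArrow.symm p))) (volume.prod volume) volume :=
    (measurePreserving_add_left volume x).comp (e.measurePreserving.comp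
      ((PiLp.volume_preserving_toLp (Fin 2)).comp
        ((volume_preserving_finTwoArrow ℝ).symm _)))
  rw [← h1.lintegral_comp hF]
  exact lintegral_prod _ (hF.comp h1.measurable).aemeasurable

/-- The one-dimensional estimate on the line `s ↦ framePoint x e t s`; its direction is a unit
vector, so the derivative along it is at most the norm of `fderiv`. -/
theorem enorm_sq_framePoint_le {φ : Plane → ℝ} (hφ : ContDiff ℝ 1 φ) (hs : HasCompactSupport φ)
    (x : Plane) (e : Plane ≃ₗᵢ[ℝ] Plane) (t a : ℝ) :
    ‖φ (framePoint x e t a)‖ₑ ^ 2 ≤ ∫⁻ s, (‖φ (framePoint x e t s)‖ₑ ^ 2 +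
      ‖fderiv ℝ φ (framePoint x e t s)‖ₑ ^ 2) := by
  have hn : ‖e !₂[(0 : ℝ), 1]‖ = 1 := by
    rw [e.norm_map]
    simp [EuclideanSpace.norm_eq]
  have hl : ∀ s, HasDerivAt (framePoint x e t) (e !₂[0, 1]) s := by
    intro s
    have : framePoint x e t = fun s => (x + t • e !₂[1, 0]) + s • e !₂[0, 1] := by
      funext s
      exact framePoint_eq x e t s
    rw [this]
    simpa using ((hasDerivAt_id s).smul_const (e !₂[(0 : ℝ), 1])).const_add (x + t • e !₂[1, 0])
  have hc : ContDiff ℝ 1 (framePoint x e t) := by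
    have : framePoint x e t = fun s => (x + t • e !₂[1, 0]) + s • e !₂[0, 1] := by
      funext s
      exact framePoint_eq x e t s
    rw [this]
    fun_prop
  have hiso : Isometry (framePoint x e t) := by
    refine Isometry.of_dist_eq fun s s' => ?_
    rw [framePoint_eq, framePoint_eq, dist_add_left, dist_eq_norm, ← sub_smul, norm_smul, hn,
      mul_one, Real.dist_eq, Real.norm_eq_abs]
  have key := enorm_sq_le_lintegral_deriv (hφ.comp hc)
    (hs.comp_isClosedEmbedding hiso.isClosedEmbedding) a
  refine key.trans (lintegral_mono fun s => ?_)
  have hd : deriv (φ ∘ framePoint x e t) s = fderiv ℝ φ (framePoint x e t s) (e !₂[0, 1]) :=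
    ((hφ.differentiable one_ne_zero _).hasFDerivAt.comp_hasDerivAt s (hl s)).deriv
  have hle : ‖fderiv ℝ φ (framePoint x e t s) (e !₂[0, 1])‖ₑ ≤
      ‖fderiv ℝ φ (framePoint x e t s)‖ₑ := by
    rw [enorm_le_iff_norm_le]
    simpa [hn] using (fderiv ℝ φ (framePoint x e t s)).le_opNorm (e !₂[0, 1])
  rw [hd]
  exact add_le_add le_rfl (by gcongr)

/-- A `K`-Lipschitz map stretches length by at most `K`. Only an upper bound on arc length is
needed, so no area formula enters. -/
theorem restrict_image_hausdorffMeasure_le {X : Type*} [EMetricSpace X] [MeasurableSpace X]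
    [BorelSpace X] {γ : ℝ → X} (hγ : Measurable γ) {K : ℝ≥0} {I : Set ℝ}
    (hK : LipschitzOnWith K γ I) {A : Set X} (hA : A ⊆ γ '' I) :
    (Measure.hausdorffMeasure 1).restrict A ≤ (K : ℝ≥0∞) • (volume.restrict I).map γ := by
  refine Measure.le_iff.2 fun B hB => ?_
  rw [Measure.restrict_apply hB, Measure.smul_apply, Measure.map_apply hγ hB,
    Measure.restrict_apply (hγ hB), smul_eq_mul]
  have hsub : B ∩ A ⊆ γ '' (γ ⁻¹' B ∩ I) := by
    rintro _ ⟨hb, ha⟩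
    obtain ⟨t, ht, rfl⟩ := hA ha
    exact ⟨t, ⟨hb, ht⟩, rfl⟩
  have := (hK.mono (inter_subset_right (s := γ ⁻¹' B))).hausdorffMeasure_image_le zero_le_one
  simpa [hausdorffMeasure_real] using (measure_mono hsub).trans this

/-- The square of the `H¹` norm of a `C¹` function on the plane. -/
def sobolevSq (φ : Plane → ℝ) : ℝ≥0∞ := ∫⁻ y, (‖φ y‖ₑ ^ 2 + ‖fderiv ℝ φ y‖ₑ ^ 2)

/-- `A` has finite length and satisfies the trace inequality. -/
def HasTraceBound (A : Set Plane) : Prop :=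
  ∃ C : ℝ≥0, Measure.hausdorffMeasure 1 A ≤ C ∧
    ∀ φ : Plane → ℝ, ContDiff ℝ 1 φ → HasCompactSupport φ →
      ∫⁻ y in A, ‖φ y‖ₑ ^ 2 ∂(Measure.hausdorffMeasure 1) ≤ C * sobolevSq φ

theorem HasTraceBound.mono {A B : Set Plane} (hAB : A ⊆ B) (hB : HasTraceBound B) :
    HasTraceBound A := by
  obtain ⟨C, h1, h2⟩ := hB
  exact ⟨C, (measure_mono hAB).trans h1, fun φ hφ hs =>
    (lintegral_mono' (Measure.restrict_mono hAB le_rfl) le_rfl).trans (h2 φ hφ hs)⟩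

theorem HasTraceBound.union {A B : Set Plane} (hA : HasTraceBound A) (hB : HasTraceBound B) :
    HasTraceBound (A ∪ B) := by
  obtain ⟨C, h1, h2⟩ := hA
  obtain ⟨C', h1', h2'⟩ := hB
  refine ⟨C + C', ?_, fun φ hφ hs => ?_⟩
  · push_cast
    exact (measure_union_le _ _).trans (add_le_add h1 h1')
  · push_cast
    rw [add_mul]
    exact (lintegral_union_le _ _ _).trans (add_le_add (h2 φ hφ hs) (h2' φ hφ hs))

/-- Arc length is dominated by `K dt`; apply the line estimate at height `ψ t` and integrate over
`t`. In the constant, `K * volume I` bounds the length and `K` serves the trace inequality. -/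
theorem hasTraceBound_graph (x : Plane) (e : Plane ≃ₗᵢ[ℝ] Plane) {ψ : ℝ → ℝ} (hψ : Continuous ψ)
    {K : ℝ≥0} {I : Set ℝ} (hI : volume I < ∞)
    (hK : LipschitzOnWith K (fun t => framePoint x e t (ψ t)) I) :
    HasTraceBound ((fun t => framePoint x e t (ψ t)) '' I) := by
  have hγ : Measurable fun t => framePoint x e t (ψ t) := by
    simp only [framePoint_eq]
    exact Continuous.measurable (by fun_prop)
  have hle := restrict_image_hausdorffMeasure_le hγ hK subset_rfl
  refine ⟨K * (volume I).toNNReal + K, ?_, fun φ hφ hs => ?_⟩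
  · have := hle univ
    simp only [Measure.restrict_apply MeasurableSet.univ, univ_inter, Measure.smul_apply,
      Measure.map_apply hγ MeasurableSet.univ, preimage_univ, smul_eq_mul] at this
    refine this.trans ?_
    push_cast
    rw [ENNReal.coe_toNNReal hI.ne]
    exact le_self_add
  · have hm : Measurable fun y => ‖φ y‖ₑ ^ 2 := (hφ.continuous.measurable.enorm).pow_const 2
    have hm' : Measurable fun y => ‖φ y‖ₑ ^ 2 + ‖fderiv ℝ φ y‖ₑ ^ 2 :=
      hm.add (((hφ.continuous_fderiv one_ne_zero).measurable.enorm).pow_const 2)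
    calc ∫⁻ y in (fun t => framePoint x e t (ψ t)) '' I, ‖φ y‖ₑ ^ 2 ∂(Measure.hausdorffMeasure 1)
        ≤ ∫⁻ y, ‖φ y‖ₑ ^ 2 ∂((K : ℝ≥0∞) • (volume.restrict I).map
            fun t => framePoint x e t (ψ t)) := lintegral_mono' hle le_rfl
      _ = K * ∫⁻ t in I, ‖φ (framePoint x e t (ψ t))‖ₑ ^ 2 := by
        rw [lintegral_smul_measure, lintegral_map hm hγ, smul_eq_mul]
      _ ≤ K * sobolevSq φ := by
        gcongr
        rw [sobolevSq, lintegral_framePoint x e hm']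
        exact (setLIntegral_le_lintegral _ _).trans
          (lintegral_mono fun t => enorm_sq_framePoint_le hφ hs x e t (ψ t))
      _ ≤ ↑(K * (volume I).toNNReal + K) * sobolevSq φ := by
        gcongr
        exact le_add_self

/-- Points above the graph have a neighbourhood missing `D`, and points below it lie in the open set
`D`; neither can be frontier points. -/
theorem eq_graph_of_mem_frontier {D : Set Plane} (hD : IsOpen D) {x : Plane}
    {e : Plane ≃ₗᵢ[ℝ] Plane} {r h : ℝ} {ψ : ℝ → ℝ} (hψ : Continuous ψ)
    (hg : ∀ z : Plane, |z 0| < r → |z 1| < h → (x + e z ∈ D ↔ z 1 < ψ (z 0)))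
    {z : Plane} (hz0 : |z 0| < r) (hz1 : |z 1| < h) (hz : x + e z ∈ frontier D) :
    z 1 = ψ (z 0) := by
  refine le_antisymm ?_ ?_
  · by_contra! hlt
    have hev : ∀ᶠ y in 𝓝 (x + e z), y ∉ D := by
      have hc : Tendsto (fun y => e.symm (y - x)) (𝓝 (x + e z)) (𝓝 z) := by
        have : ContinuousAt (fun y => e.symm (y - x)) (x + e z) := by fun_prop
        simpa [ContinuousAt] using this
      have h0 : ∀ᶠ w : Plane in 𝓝 z, |w 0| < r ∧ |w 1| < h ∧ ψ (w 0) < w 1 :=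
        (ContinuousAt.eventually_lt (by fun_prop) (by fun_prop) hz0).and
          ((ContinuousAt.eventually_lt (by fun_prop) (by fun_prop) hz1).and
            (ContinuousAt.eventually_lt (f := fun w : Plane => ψ (w 0)) (g := fun w => w 1)
              (by fun_prop) (by fun_prop) hlt))
      filter_upwards [hc.eventually h0] with y hy hyD
      have := (hg _ hy.1 hy.2.1).1 (by simpa using hyD)
      exact absurd this hy.2.2.not_gt
    exact (mem_closure_iff_frequently.1 hz.1) hev
  · by_contra! hlt
    have := (hg z hz0 hz1).2 hlt
    rw [hD.frontier_eq] at hz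
    exact hz.2 this

theorem hasTraceBound_frontier {D : Set Plane} (hD : IsOpen D) (hb : Bornology.IsBounded D)
    (hC2 : HasC2Boundary D) : HasTraceBound (frontier D) := by
  have hK : IsCompact (frontier D) :=
    Metric.isCompact_of_isClosed_isBounded isClosed_frontier
      (hb.closure.subset frontier_subset_closure)
  refine hK.induction_on (p := HasTraceBound) ⟨0, by simp⟩ (fun _ _ hst ht => ht.mono hst)
    (fun _ _ hs ht => hs.union ht) fun x hx => ?_
  obtain ⟨e, r, h, ψ, hr, hh, hψ, hg⟩ := hC2 x hx
  have hγ : ContDiffAt ℝ 1 (fun t => framePoint x e t (ψ t)) 0 := by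
    have h1 : ContDiff ℝ 1 ψ := hψ.of_le (by norm_num)
    simp only [framePoint_eq]
    exact ContDiff.contDiffAt (by fun_prop)
  -- A `C¹` curve is Lipschitz only locally, so the chart is shrunk to a neighbourhood of `0`;
  -- intersecting with `Ioo (-r) r` keeps it inside the chart and of finite length.
  obtain ⟨K, t, ht, hL⟩ := hγ.exists_lipschitzOnWith
  have hI : volume (t ∩ Ioo (-r) r) < ∞ :=
    (measure_mono inter_subset_right).trans_lt (by simp)
  have hB := hasTraceBound_graph x e hψ.continuous hI (hL.mono inter_subset_left)
  refine ⟨_, ?_, hB⟩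
  have hc : Tendsto (fun y => e.symm (y - x)) (𝓝 x) (𝓝 0) := by
    have : ContinuousAt (fun y => e.symm (y - x)) x := by fun_prop
    simpa [ContinuousAt] using this
  have h0 : Tendsto (fun w : Plane => w 0) (𝓝 0) (𝓝 0) := by
    have : Continuous fun w : Plane => w 0 := by fun_prop
    simpa using this.tendsto 0
  have h1 : Tendsto (fun w : Plane => w 1) (𝓝 0) (𝓝 0) := by
    have : Continuous fun w : Plane => w 1 := by fun_prop
    simpa using this.tendsto 0
  have hIn : t ∩ Ioo (-r) r ∈ 𝓝 (0 : ℝ) := inter_mem ht (Ioo_mem_nhds (by linarith) hr)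
  filter_upwards [self_mem_nhdsWithin, nhdsWithin_le_nhds ((h0.comp hc).eventually hIn),
    nhdsWithin_le_nhds ((h1.comp hc).eventually (Ioo_mem_nhds (neg_lt_zero.2 hh) hh))]
    with y hy hy0 hy1
  have hyz : x + e (e.symm (y - x)) = y := by simp
  refine ⟨e.symm (y - x) 0, hy0, ?_⟩
  simp only
  rw [← eq_graph_of_mem_frontier hD hψ.continuous hg (abs_lt.2 hy0.2) (abs_lt.2 hy1)
    (by rwa [hyz]), framePoint_apply, hyz]

/-- Finite one-dimensional measure forces two-dimensional Hausdorff measure zero, and Lebesgue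
measure is a multiple of the latter by uniqueness of Haar measure. -/
theorem HasTraceBound.volume_eq_zero {A : Set Plane} (hA : HasTraceBound A) : volume A = 0 := by
  obtain ⟨C, hC, -⟩ := hA
  have h2 : Measure.hausdorffMeasure (2 : ℕ) A = 0 :=
    (Measure.hausdorffMeasure_zero_or_top (by norm_num) A).resolve_right
      (hC.trans_lt ENNReal.coe_lt_top).ne
  rw [Measure.isAddLeftInvariant_eq_smul (volume : Measure Plane)
    (Measure.hausdorffMeasure (2 : ℕ)), Measure.smul_apply, h2, smul_zero]

/-! ### The trace operator and the Poincaré inequality -/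

theorem gradient_eq_symm (φ : Plane → ℝ) :
    ∇ φ = fun x => (InnerProductSpace.toDual ℝ Plane).symm (fderiv ℝ φ x) := rfl

theorem enorm_gradient (φ : Plane → ℝ) (x : Plane) : ‖(∇ φ) x‖ₑ = ‖fderiv ℝ φ x‖ₑ := by
  rw [gradient_eq_symm]
  exact (InnerProductSpace.toDual ℝ Plane).symm.toLinearIsometry.enorm_map _

theorem enorm_toLp_sq {X E : Type*} [MeasurableSpace X] [NormedAddCommGroup E] {μ : Measure X}
    {f : X → E} (hf : MemLp f 2 μ) : ‖hf.toLp f‖ₑ ^ 2 = ∫⁻ x, ‖f x‖ₑ ^ 2 ∂μ := by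
  rw [Lp.enorm_toLp]
  have := eLpNorm_nnreal_pow_eq_lintegral (p := 2) (μ := μ) (f := f) (by simp)
  simpa using this

theorem enorm_ofTest_sq {Ω : Opens Plane} (φ : 𝓓(Ω, ℝ)) : ‖ofTest φ‖ₑ ^ 2 = sobolevSq φ := by
  have h1 : ‖ofTest φ‖ ^ 2 = ‖(memLp_test φ).toLp φ‖ ^ 2 +
      ‖(memLp_gradient_test φ).toLp (∇ φ)‖ ^ 2 := WithLp.prod_norm_sq_eq_of_L2 (testPair φ)
  have h2 : ‖ofTest φ‖ₑ ^ 2 = ‖(memLp_test φ).toLp φ‖ₑ ^ 2 +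
      ‖(memLp_gradient_test φ).toLp (∇ φ)‖ₑ ^ 2 := by
    simp only [← ofReal_norm]
    rw [← ENNReal.ofReal_pow (norm_nonneg _), h1, ENNReal.ofReal_add (by positivity)
      (by positivity), ENNReal.ofReal_pow (norm_nonneg _), ENNReal.ofReal_pow (norm_nonneg _)]
  have hm : Measurable fun y => ‖φ y‖ₑ ^ 2 := (φ.continuous.measurable.enorm).pow_const 2
  rw [h2, enorm_toLp_sq, enorm_toLp_sq, ← lintegral_add_left hm, sobolevSq]
  simp only [enorm_gradient]
  refine setLIntegral_eq_of_support_subset ?_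
  intro y hy
  by_contra hyΩ
  have hy' : y ∉ tsupport φ := fun h => hyΩ (φ.tsupport_subset h)
  refine hy ?_
  have hd : ‖(∇ φ) y‖ₑ = 0 := by
    rw [gradient, image_eq_zero_of_notMem_tsupport fun h =>
      hy' (tsupport_fderiv_subset ℝ h), map_zero, enorm_zero]
  simp [← enorm_gradient, hd, image_eq_zero_of_notMem_tsupport hy']

/-- The inclusion `C_c^∞(Ω) → H¹₀(Ω)` as a linear map. -/
def ofTestₗ (Ω : Opens Plane) : 𝓓(Ω, ℝ) →ₗ[ℝ] H10 Ω where
  toFun := ofTest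
  map_add' φ η := by
    have h1 := φ.contDiff.differentiable (by simp)
    have h2 := η.contDiff.differentiable (by simp)
    refine Subtype.ext (WithLp.ofLp_injective 2 (Prod.ext ?_ ?_))
    · exact MemLp.toLp_add (memLp_test φ) (memLp_test η)
    · refine Eq.trans ?_ (MemLp.toLp_add (memLp_gradient_test φ) (memLp_gradient_test η))
      refine MemLp.toLp_congr (memLp_gradient_test (φ + η)) _ (Filter.Eventually.of_forall fun x => ?_)
      simp only [gradient_eq_symm, Pi.add_apply]
      rw [FunLike.coe_add, fderiv_add (h1 x) (h2 x), map_add]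
  map_smul' c φ := by
    have h1 := φ.contDiff.differentiable (by simp)
    refine Subtype.ext (WithLp.ofLp_injective 2 (Prod.ext ?_ ?_))
    · exact MemLp.toLp_const_smul c (memLp_test φ)
    · refine Eq.trans ?_ (MemLp.toLp_const_smul c (memLp_gradient_test φ))
      refine MemLp.toLp_congr (memLp_gradient_test (c • φ)) _ (Filter.Eventually.of_forall fun x => ?_)
      simp only [gradient_eq_symm, Pi.smul_apply]
      rw [FunLike.coe_smul, fderiv_const_smul (h1 x), map_smul]

/-- By linearity of `ofTestₗ` the test pairs already form a subspace, so the span in the definition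
of `H10` adds nothing. -/
theorem denseRange_ofTest (Ω : Opens Plane) : DenseRange (ofTest (Ω := Ω)) := by
  have hs : Submodule.span ℝ (range (testPair (Ω := Ω))) =
      LinearMap.range ((H10 Ω).subtype ∘ₗ ofTestₗ Ω) := by
    refine le_antisymm (Submodule.span_le.2 ?_) ?_
    · rintro _ ⟨φ, rfl⟩
      exact ⟨φ, rfl⟩
    · rintro _ ⟨φ, rfl⟩
      exact Submodule.subset_span ⟨φ, rfl⟩
  intro y
  rw [closure_subtype]
  have hy : (y : L2Pair Ω) ∈ closure
      (Submodule.span ℝ (range (testPair (Ω := Ω))) : Set (L2Pair Ω)) := y.2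
  rw [hs] at hy
  refine closure_mono ?_ hy
  rintro _ ⟨φ, rfl⟩
  exact ⟨ofTest φ, ⟨φ, rfl⟩, rfl⟩

instance (Ω : Opens Plane) : CompleteSpace (H10 Ω) :=
  (Submodule.isClosed_topologicalClosure _).completeSpace_coe

theorem HasTraceBound.isFiniteMeasure {Ωm : Opens Plane} (h : HasTraceBound (interface Ωm)) :
    IsFiniteMeasure (arcLength Ωm) := by
  obtain ⟨C, hC, -⟩ := h
  exact ⟨by simpa using hC.trans_lt ENNReal.coe_lt_top⟩

theorem memLp_test_interface {Ω Ωm : Opens Plane} [IsFiniteMeasure (arcLength Ωm)]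
    (φ : 𝓓(Ω, ℝ)) : MemLp φ 2 (arcLength Ωm) :=
  φ.continuous.memLp_of_hasCompactSupport φ.hasCompactSupport

/-- The restriction `φ ↦ φ|_Γ` of test functions. -/
def testTrace (Ω Ωm : Opens Plane) [IsFiniteMeasure (arcLength Ωm)] :
    𝓓(Ω, ℝ) →ₗ[ℝ] L2Interface Ωm where
  toFun φ := (memLp_test_interface φ).toLp φ
  map_add' φ η := MemLp.toLp_add (memLp_test_interface φ) (memLp_test_interface η)
  map_smul' c φ := MemLp.toLp_const_smul c (memLp_test_interface φ)

theorem norm_testTrace_le {Ω Ωm : Opens Plane} [IsFiniteMeasure (arcLength Ωm)]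
    (h : HasTraceBound (interface Ωm)) :
    ∃ C : ℝ, ∀ φ : 𝓓(Ω, ℝ), ‖testTrace Ω Ωm φ‖ ≤ C * ‖ofTestₗ Ω φ‖ := by
  obtain ⟨C, -, hC⟩ := h
  refine ⟨√C, fun φ => ?_⟩
  have h1 : ‖testTrace Ω Ωm φ‖ₑ ^ 2 ≤ C * ‖ofTest φ‖ₑ ^ 2 := by
    rw [enorm_ofTest_sq]
    exact (enorm_toLp_sq (memLp_test_interface φ)).trans_le
      (hC φ (φ.contDiff.of_le (by simp)) φ.hasCompactSupport)
  have h2 : ‖testTrace Ω Ωm φ‖ ^ 2 ≤ C * ‖ofTest φ‖ ^ 2 := by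
    simp only [enorm_eq_nnnorm] at h1
    exact_mod_cast h1
  refine le_of_sq_le_sq ?_ (by positivity)
  rw [mul_pow, Real.sq_sqrt C.coe_nonneg]
  exact h2

theorem existsUnique_traceOperator {Ω Ωm : Opens Plane} (h : HasTraceBound (interface Ωm)) :
    ∃! T : H10 Ω →L[ℝ] L2Interface Ωm, IsTraceOperator T := by
  have := h.isFiniteMeasure
  have key : ∀ T : H10 Ω →L[ℝ] L2Interface Ωm,
      IsTraceOperator T ↔ ∀ φ, T (ofTest φ) = testTrace Ω Ωm φ := fun T =>
    forall_congr' fun φ => by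
      rw [Lp.ext_iff]
      have hφ : testTrace Ω Ωm φ =ᵐ[arcLength Ωm] φ := (memLp_test_interface φ).coeFn_toLp
      exact ⟨fun hT => (show T (ofTest φ) =ᵐ[arcLength Ωm] φ from hT).trans hφ.symm,
        fun hT => hT.trans hφ⟩
  refine ⟨(testTrace Ω Ωm).extendOfNorm (ofTestₗ Ω), (key _).2 fun φ => ?_, fun T hT => ?_⟩
  · exact LinearMap.extendOfNorm_eq (denseRange_ofTest Ω) (norm_testTrace_le h) φ
  · obtain ⟨C, hC⟩ := norm_testTrace_le (Ω := Ω) h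
    exact (LinearMap.extendOfNorm_unique (denseRange_ofTest Ω) C hC T
      (LinearMap.ext ((key T).1 hT))).symm

/-- `H10.val` as a continuous linear map. -/
def H10.valL (Ω : Opens Plane) : H10 Ω →L[ℝ] L2 Ω := WithLp.fstL 2 ℝ _ _ ∘L (H10 Ω).subtypeL

/-- `H10.grad` as a continuous linear map. -/
def H10.gradL (Ω : Opens Plane) : H10 Ω →L[ℝ] L2Vec Ω := WithLp.sndL 2 ℝ _ _ ∘L (H10 Ω).subtypeL

theorem H10.valL_apply {Ω : Opens Plane} (y : H10 Ω) : H10.valL Ω y = H10.val y := rfl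

theorem H10.norm_sq_eq {Ω : Opens Plane} (y : H10 Ω) :
    ‖y‖ ^ 2 = ‖H10.val y‖ ^ 2 + ‖H10.grad y‖ ^ 2 :=
  WithLp.prod_norm_sq_eq_of_L2 (y : L2Pair Ω)

theorem eLpNorm_test_le_gradient {Ω : Opens Plane} (hb : Bornology.IsBounded (Ω : Set Plane)) :
    ∃ C : ℝ≥0, ∀ φ : 𝓓(Ω, ℝ),
      eLpNorm φ 2 (volOn Ω) ≤ C * eLpNorm (∇ φ) 2 (volOn Ω) := by
  set c := eLpNormLESNormFDerivOfLeConst ℝ (volume : Measure Plane) (Ω : Set Plane) 1 2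
  refine ⟨c * ((volume (Ω : Set Plane)).toNNReal) ^ (1 / 2 : ℝ), fun φ => ?_⟩
  have hsupp : Function.support φ ⊆ (Ω : Set Plane) :=
    (subset_tsupport φ).trans φ.tsupport_subset
  have hsupp' : Function.support (∇ φ) ⊆ (Ω : Set Plane) := by
    refine Subset.trans (fun x hx => ?_)
      ((subset_tsupport _).trans ((tsupport_fderiv_subset ℝ).trans φ.tsupport_subset))
    rw [Function.mem_support] at hx ⊢
    contrapose! hx
    rw [gradient, hx, map_zero]
  -- In the plane `W^{1,1}` embeds into `L²`; Hölder on the bounded set `Ω` then passes from the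
  -- `L¹` to the `L²` norm of the gradient, at the cost of `|Ω|^{1/2}`.
  have hgns := eLpNorm_le_eLpNorm_fderiv_of_le (volume : Measure Plane)
    (φ.contDiff.of_le (by simp)) hsupp (p := 1) (q := 2) le_rfl (by simp) (by norm_num) hb
  have hμ : volume (Ω : Set Plane) ≠ ∞ := hb.measure_lt_top.ne
  have hholder := eLpNorm_le_eLpNorm_mul_rpow_measure_univ (μ := volOn Ω) (f := ∇ φ)
    (p := 1) (q := 2) (by norm_num) (memLp_gradient_test φ).1
  have hgrad : eLpNorm (fderiv ℝ φ) (1 : ℝ≥0) volume = eLpNorm (∇ φ) 1 volume :=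
    eLpNorm_congr_enorm_ae (Filter.Eventually.of_forall fun x => (enorm_gradient φ x).symm)
  rw [eLpNorm_restrict_eq_of_support_subset (p := 1) hsupp', ← hgrad] at hholder
  rw [eLpNorm_restrict_eq_of_support_subset hsupp]
  refine (hgns.trans (mul_le_mul_right hholder _)).trans_eq ?_
  rw [ENNReal.coe_mul, ENNReal.coe_rpow_of_nonneg _ (by norm_num), ENNReal.coe_toNNReal hμ]
  norm_num
  ring

/-- Poincaré's inequality. -/
theorem norm_val_le_norm_grad {Ω : Opens Plane} (hb : Bornology.IsBounded (Ω : Set Plane)) :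
    ∃ C : ℝ, ∀ y : H10 Ω, ‖H10.val y‖ ≤ C * ‖H10.grad y‖ := by
  obtain ⟨C, hC⟩ := eLpNorm_test_le_gradient hb
  refine ⟨C, fun y => ?_⟩
  refine (denseRange_ofTest Ω).induction_on (p := fun y => ‖H10.val y‖ ≤ C * ‖H10.grad y‖) y
    (isClosed_le (H10.valL Ω).continuous.norm
      (continuous_const.mul (H10.gradL Ω).continuous.norm)) fun φ => ?_
  have h := hC φ
  rw [← Lp.enorm_toLp (memLp_test φ), ← Lp.enorm_toLp (memLp_gradient_test φ)] at h
  simp only [enorm_eq_nnnorm] at h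
  exact_mod_cast h

/-! ### Quadratic minimization over closed convex sets -/

section Minimization

variable {H G E : Type*} [NormedAddCommGroup H] [InnerProductSpace ℝ H] [CompleteSpace H]
  [NormedAddCommGroup G] [InnerProductSpace ℝ G] [NormedAddCommGroup E] [InnerProductSpace ℝ E]

/-- Project `-c` onto `L '' U`, which is complete because `L` is bounded below, so that `E` itself
need not be complete. -/
theorem existsUnique_forall_norm_le (L : H →L[ℝ] E) {K : NNReal} (hL : AntilipschitzWith K L)
    (c : E) {U : Set H} (hne : U.Nonempty) (hconv : Convex ℝ U) (hcl : IsClosed U) :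
    ∃! u, u ∈ U ∧ ∀ w ∈ U, ‖L u + c‖ ≤ ‖L w + c‖ := by
  have hcomp : IsComplete (L '' U) :=
    (isComplete_image_iff (hL.isUniformInducing L.uniformContinuous)).2 hcl.isComplete
  have hc : Convex ℝ (L '' U) := hconv.linear_image L.toLinearMap
  obtain ⟨_, ⟨u, hu, rfl⟩, hmin⟩ :=
    exists_norm_eq_iInf_of_complete_convex (hne.image L) hcomp hc (-c)
  have hnorm : ∀ w, ‖-c - L w‖ = ‖L w + c‖ := fun w => by
    rw [← norm_neg]
    congr 1
    abel
  have hmin' : ∀ w ∈ U, ‖L u + c‖ ≤ ‖L w + c‖ := fun w hw => by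
    rw [← hnorm, ← hnorm, hmin]
    exact ciInf_le ⟨0, forall_mem_range.2 fun _ => norm_nonneg _⟩
      (⟨L w, mem_image_of_mem L hw⟩ : L '' U)
  refine ⟨u, ⟨hu, hmin'⟩, fun w ⟨hw, hwmin⟩ => ?_⟩
  have heq : ‖L w + c‖ = ‖L u + c‖ := le_antisymm (hwmin u hu) (hmin' w hw)
  have hmid := hmin' _ (hconv hw hu (a := 1 / 2) (b := 1 / 2) (by norm_num) (by norm_num)
    (by norm_num))
  have hexp : L ((1 / 2 : ℝ) • w + (1 / 2 : ℝ) • u) + c =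
      (1 / 2 : ℝ) • ((L w + c) + (L u + c)) := by
    rw [map_add, map_smul, map_smul]
    module
  rw [hexp, norm_smul, Real.norm_of_nonneg (by norm_num)] at hmid
  -- For two minimizers, minimality at the midpoint gives `‖sum‖ ≥ 2‖L u + c‖`, so the parallelogram
  -- law leaves no room for a nonzero difference.
  have hpar := parallelogram_law_with_norm ℝ (L w + c) (L u + c)
  rw [heq] at hpar
  have h0 : ‖(L w + c) - (L u + c)‖ = 0 := by
    nlinarith [norm_nonneg ((L w + c) - (L u + c)), norm_nonneg (L u + c),
      norm_nonneg ((L w + c) + (L u + c))]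
  refine hL.injective ?_
  simpa [sub_eq_zero] using h0

theorem existsUnique_forall_tikhonov_le (A : H →L[ℝ] G) (b : G) {α : ℝ} (hα : 0 < α) {U : Set H}
    (hne : U.Nonempty) (hconv : Convex ℝ U) (hcl : IsClosed U) :
    ∃! u, u ∈ U ∧ ∀ w ∈ U, 1 / 2 * ‖A u + b‖ ^ 2 + α / 2 * ‖u‖ ^ 2 ≤
      1 / 2 * ‖A w + b‖ ^ 2 + α / 2 * ‖w‖ ^ 2 := by
  -- With `L w = (A w, √α w)` and `c = (b, 0)`, the objective is `½‖L w + c‖²`; the second component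
  -- alone gives the lower bound `√α`.
  let L : H →L[ℝ] WithLp 2 (G × H) :=
    (WithLp.prodContinuousLinearEquiv 2 ℝ G H).symm.toContinuousLinearMap ∘L
      (A.prod (√α • ContinuousLinearMap.id ℝ H))
  have hsq : ∀ w, ‖L w + WithLp.toLp 2 (b, 0)‖ ^ 2 = ‖A w + b‖ ^ 2 + α * ‖w‖ ^ 2 := fun w => by
    rw [WithLp.prod_norm_sq_eq_of_L2]
    simp [L, norm_smul, mul_pow, Real.sq_sqrt hα.le, abs_of_nonneg]
  have hL : AntilipschitzWith (Real.toNNReal (√α)⁻¹) L := by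
    refine AddMonoidHomClass.antilipschitz_of_bound L fun w => ?_
    have h1 : ‖√α • w‖ ≤ ‖L w‖ := WithLp.norm_snd_le _ (L w)
    rw [norm_smul, Real.norm_of_nonneg (Real.sqrt_nonneg α)] at h1
    rw [Real.coe_toNNReal _ (by positivity), inv_mul_eq_div, le_div_iff₀ (by positivity),
      mul_comm]
    exact h1
  have := existsUnique_forall_norm_le L hL (WithLp.toLp 2 (b, 0)) hne hconv hcl
  refine (existsUnique_congr fun u => and_congr_right fun _ => forall₂_congr fun w _ => ?_).1 this
  rw [← sq_le_sq₀ (norm_nonneg _) (norm_nonneg _), hsq, hsq]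
  constructor <;> intro h <;> linarith

end Minimization

/-! ### The state equation -/

/-- Restriction of vector fields from `Ω` to a subset. -/
def restrictVec (Ω : Opens Plane) (A : Set Plane) :
    L2Vec Ω →L[ℝ] Lp Plane 2 ((volOn Ω).restrict A) :=
  LpToLpRestrictCLM Plane Plane ℝ (volOn Ω) 2 A

theorem inner_restrictVec {Ω : Opens Plane} {A : Set Plane} (hA : MeasurableSet A)
    (hAΩ : A ⊆ Ω) (g k : L2Vec Ω) :
    ⟪restrictVec Ω A g, restrictVec Ω A k⟫_ℝ = ∫ x in A, ⟪g x, k x⟫_ℝ := by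
  have hr : (volOn Ω).restrict A = volume.restrict A := by
    rw [Measure.restrict_restrict hA, inter_eq_left.2 hAΩ]
  rw [L2.inner_def, ← hr]
  refine integral_congr_ae ?_
  filter_upwards [LpToLpRestrictCLM_coeFn ℝ A g, LpToLpRestrictCLM_coeFn ℝ A k] with x h1 h2
  rw [restrictVec, h1, h2]

theorem measurableSet_outer (Ω Ωm : Opens Plane) : MeasurableSet (outer Ω Ωm) :=
  Ω.isOpen.measurableSet.diff isClosed_closure.measurableSet

theorem outer_subset (Ω Ωm : Opens Plane) : outer Ω Ωm ⊆ Ω := sdiff_subset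

/-- The two subdomains are disjoint and exhaust `Ω` up to the null set `Γ`. -/
theorem norm_sq_eq_restrictVec_add {Ω Ωm : Opens Plane} (hsub : closure (Ωm : Set Plane) ⊆ Ω)
    (h0 : volume (interface Ωm) = 0) (g : L2Vec Ω) :
    ‖g‖ ^ 2 = ‖restrictVec Ω Ωm g‖ ^ 2 + ‖restrictVec Ω (outer Ω Ωm) g‖ ^ 2 := by
  have hdisj : Disjoint (Ωm : Set Plane) (outer Ω Ωm) :=
    disjoint_sdiff_right.mono_left subset_closure
  rw [← real_inner_self_eq_norm_sq, ← real_inner_self_eq_norm_sq, ← real_inner_self_eq_norm_sq,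
    inner_restrictVec Ωm.isOpen.measurableSet (subset_closure.trans hsub),
    inner_restrictVec (measurableSet_outer Ω Ωm) (outer_subset Ω Ωm), L2.inner_def]
  have hint : IntegrableOn (fun x => ⟪g x, g x⟫_ℝ) (Ω : Set Plane) := L2.integrable_inner g g
  rw [← setIntegral_union hdisj (measurableSet_outer Ω Ωm)
    (hint.mono_set (subset_closure.trans hsub)) (hint.mono_set (outer_subset Ω Ωm))]
  refine setIntegral_congr_set (Filter.EventuallyEq.symm ?_)
  have hsub' : (Ωm : Set Plane) ∪ outer Ω Ωm ⊆ Ω :=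
    union_subset (subset_closure.trans hsub) (outer_subset Ω Ωm)
  refine hsub'.eventuallyLE.antisymm (ae_le_set.2 (measure_mono_null ?_ h0))
  rintro x ⟨hx, hx'⟩
  rw [interface, Ωm.isOpen.frontier_eq]
  by_contra hxΓ
  refine hx' ?_
  by_cases hc : x ∈ closure (Ωm : Set Plane)
  · exact Or.inl (by_contra fun h => hxΓ ⟨hc, h⟩)
  · exact Or.inr ⟨hx, hc⟩

/-- The bilinear form `a(·,·)` as a continuous bilinear map. -/
def bilinL (Ω Ωm : Opens Plane) (βm βp : ℝ) : H10 Ω →L[ℝ] H10 Ω →L[ℝ] ℝ :=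
  βm • (innerSL ℝ).bilinearComp (restrictVec Ω Ωm ∘L H10.gradL Ω)
      (restrictVec Ω Ωm ∘L H10.gradL Ω) +
    βp • (innerSL ℝ).bilinearComp (restrictVec Ω (outer Ω Ωm) ∘L H10.gradL Ω)
      (restrictVec Ω (outer Ω Ωm) ∘L H10.gradL Ω)

theorem bilinL_apply_eq_inner {Ω Ωm : Opens Plane} (βm βp : ℝ) (y v : H10 Ω) :
    bilinL Ω Ωm βm βp y v =
      βm * ⟪restrictVec Ω Ωm (H10.grad y), restrictVec Ω Ωm (H10.grad v)⟫_ℝ +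
      βp * ⟪restrictVec Ω (outer Ω Ωm) (H10.grad y), restrictVec Ω (outer Ω Ωm) (H10.grad v)⟫_ℝ :=
  rfl

theorem bilinL_apply {Ω Ωm : Opens Plane} (hsub : closure (Ωm : Set Plane) ⊆ Ω) (βm βp : ℝ)
    (y v : H10 Ω) : bilinL Ω Ωm βm βp y v = bilin Ωm βm βp y v := by
  rw [bilinL_apply_eq_inner, inner_restrictVec Ωm.isOpen.measurableSet (subset_closure.trans hsub),
    inner_restrictVec (measurableSet_outer Ω Ωm) (outer_subset Ω Ωm), bilin,
    integral_const_mul, integral_const_mul]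

theorem isCoercive_bilinL {Ω Ωm : Opens Plane} (hb : Bornology.IsBounded (Ω : Set Plane))
    (hsub : closure (Ωm : Set Plane) ⊆ Ω) (h0 : volume (interface Ωm) = 0) {βm βp : ℝ}
    (hβm : 0 < βm) (hβp : 0 < βp) : IsCoercive (bilinL Ω Ωm βm βp) := by
  obtain ⟨C, hC⟩ := norm_val_le_norm_grad hb
  have hβ : 0 < min βm βp := lt_min hβm hβp
  -- Poincaré bounds `‖y‖²` by `(C² + 1)‖∇y‖²`, and the smaller coefficient bounds the form below.
  refine ⟨min βm βp / (C ^ 2 + 1), by positivity, fun y => ?_⟩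
  have h1 : ‖y‖ ^ 2 ≤ (C ^ 2 + 1) * ‖H10.grad y‖ ^ 2 := by
    rw [H10.norm_sq_eq, add_mul, one_mul, ← mul_pow]
    gcongr
    exact hC y
  rw [bilinL_apply_eq_inner, real_inner_self_eq_norm_sq, real_inner_self_eq_norm_sq]
  calc min βm βp / (C ^ 2 + 1) * ‖y‖ * ‖y‖ = min βm βp / (C ^ 2 + 1) * ‖y‖ ^ 2 := by ring
    _ ≤ min βm βp / (C ^ 2 + 1) * ((C ^ 2 + 1) * ‖H10.grad y‖ ^ 2) := by gcongr
    _ = min βm βp * ‖H10.grad y‖ ^ 2 := by field_simp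
    _ = min βm βp * ‖restrictVec Ω Ωm (H10.grad y)‖ ^ 2 +
        min βm βp * ‖restrictVec Ω (outer Ω Ωm) (H10.grad y)‖ ^ 2 := by
      rw [norm_sq_eq_restrictVec_add hsub h0, mul_add]
    _ ≤ βm * ‖restrictVec Ω Ωm (H10.grad y)‖ ^ 2 +
        βp * ‖restrictVec Ω (outer Ω Ωm) (H10.grad y)‖ ^ 2 := by
      gcongr
      · exact min_le_left _ _
      · exact min_le_right _ _

theorem inner_eq_integral_mul {X : Type*} [MeasurableSpace X] {μ : Measure X} (f g : Lp ℝ 2 μ) :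
    ⟪f, g⟫_ℝ = ∫ x, f x * g x ∂μ := by
  rw [L2.inner_def]
  simp [mul_comm]

/-- The adjoints of `H10.valL` and `T` give the Riesz representatives of both load terms;
Lax–Milgram inverts the form. The resulting formula is affine in `u`. -/
theorem isWeakState_iff {Ω Ωm : Opens Plane} (hsub : closure (Ωm : Set Plane) ⊆ Ω)
    {T : H10 Ω →L[ℝ] L2Interface Ωm} {βm βp : ℝ} (hB : IsCoercive (bilinL Ω Ωm βm βp))
    {f : L2 Ω} {u : L2Interface Ωm} {y : H10 Ω} :
    IsWeakState T βm βp f u y ↔ y = hB.continuousLinearEquivOfBilin.symm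
      ((H10.valL Ω).adjoint f + T.adjoint u) := by
  rw [ContinuousLinearEquiv.eq_symm_apply, ext_iff_inner_right ℝ]
  refine forall_congr' fun v => ?_
  rw [hB.continuousLinearEquivOfBilin_apply, bilinL_apply hsub, inner_add_left,
    ContinuousLinearMap.adjoint_inner_left, ContinuousLinearMap.adjoint_inner_left,
    H10.valL_apply, inner_eq_integral_mul, inner_eq_integral_mul]

/-! ### The optimal control problem -/

theorem norm_sq_eq_integral {X : Type*} [MeasurableSpace X] {μ : Measure X} (f : Lp ℝ 2 μ) :
    ‖f‖ ^ 2 = ∫ x, f x ^ 2 ∂μ := by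
  rw [← real_inner_self_eq_norm_sq, inner_eq_integral_mul]
  simp [sq]

theorem cost_eq {Ω Ωm : Opens Plane} (α : ℝ) (yd : L2 Ω) (y : H10 Ω) (u : L2Interface Ωm) :
    cost α yd y u = 1 / 2 * ‖H10.val y - yd‖ ^ 2 + α / 2 * ‖u‖ ^ 2 := by
  rw [cost, norm_sq_eq_integral, norm_sq_eq_integral]
  congr 2
  refine integral_congr_ae ?_
  filter_upwards [Lp.coeFn_sub (H10.val y) yd] with x hx
  rw [hx, Pi.sub_apply]

theorem isReducedSolution_iff_isOptimalPair {Ω Ωm : Opens Plane}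
    {T : H10 Ω →L[ℝ] L2Interface Ωm} {βm βp : ℝ} {f : L2 Ω} {S : L2Interface Ωm → H10 Ω}
    (hS : ∀ u y, IsWeakState T βm βp f u y ↔ y = S u) (α : ℝ) (yd : L2 Ω)
    (U : Set (L2Interface Ωm)) (p : H10 Ω × L2Interface Ωm) :
    IsReducedSolution S α yd U p ↔ IsOptimalPair T βm βp f α yd U p := by
  refine and_congr_right fun _ => ?_
  rw [hS]
  refine and_congr_right fun hp => ?_
  simp only [hS, cost_eq, reducedCost, hp]
  exact ⟨fun h y u hu hy => hy ▸ h u hu, fun h u hu => h _ u hu rfl⟩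

theorem existsUnique_isReducedSolution {Ω Ωm : Opens Plane} {S : L2Interface Ωm → H10 Ω}
    {A : L2Interface Ωm →L[ℝ] L2 Ω} {b : L2 Ω} (hA : ∀ u, H10.val (S u) = A u + b) {α : ℝ}
    (hα : 0 < α) (yd : L2 Ω) {U : Set (L2Interface Ωm)} (hne : U.Nonempty) (hconv : Convex ℝ U)
    (hcl : IsClosed U) : ∃! p, IsReducedSolution S α yd U p := by
  obtain ⟨u, ⟨hu, hmin⟩, huniq⟩ :=
    existsUnique_forall_tikhonov_le A (b - yd) hα hne hconv hcl
  have hcost : ∀ w, reducedCost S α yd w =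
      1 / 2 * ‖A w + (b - yd)‖ ^ 2 + α / 2 * ‖w‖ ^ 2 := fun w => by
    rw [reducedCost, hA, add_sub_assoc]
  refine ⟨(S u, u), ⟨hu, rfl, fun w hw => ?_⟩, ?_⟩
  · rw [hcost, hcost]
    exact hmin w hw
  · rintro ⟨y, w⟩ ⟨hw, hy, hwmin⟩
    simp only [hcost] at hwmin
    have hwu := huniq w ⟨hw, hwmin⟩
    simp only at hy
    rw [hy, hwu]

/-- Used for closedness, since order intervals in `Lp` are closed; finite length puts the constants
in `L²(Γ)`. -/
theorem boxControls_eq_Icc {Ωm : Opens Plane} [IsFiniteMeasure (arcLength Ωm)] (ua ub : ℝ) :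
    boxControls Ωm ua ub =
      Icc (Lp.const 2 (arcLength Ωm) ua) (Lp.const 2 (arcLength Ωm) ub) := by
  ext u
  rw [mem_Icc, ← Lp.coeFn_le, ← Lp.coeFn_le]
  refine (Filter.eventually_and (f := ae (arcLength Ωm))).trans (and_congr ?_ ?_)
  · refine Filter.eventually_congr ?_
    filter_upwards [Lp.coeFn_const (p := 2) (arcLength Ωm) ua] with x hx
    rw [hx, Function.const_apply]
  · refine Filter.eventually_congr ?_
    filter_upwards [Lp.coeFn_const (p := 2) (arcLength Ωm) ub] with x hx
    rw [hx, Function.const_apply]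

theorem convex_boxControls (Ωm : Opens Plane) (ua ub : ℝ) : Convex ℝ (boxControls Ωm ua ub) := by
  intro u hu v hv a b ha hb hab
  have hu' : ∀ᵐ x ∂(arcLength Ωm), u x ∈ Icc ua ub := hu
  have hv' : ∀ᵐ x ∂(arcLength Ωm), v x ∈ Icc ua ub := hv
  filter_upwards [hu', hv', Lp.coeFn_add (a • u) (b • v), Lp.coeFn_smul a u, Lp.coeFn_smul b v]
    with x h1 h2 h3 h4 h5
  have := convex_Icc ua ub h1 h2 ha hb hab
  rw [h3, Pi.add_apply, h4, h5]
  exact this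

theorem boxControls_nonempty {Ωm : Opens Plane} [IsFiniteMeasure (arcLength Ωm)] {ua ub : ℝ}
    (h : ua ≤ ub) : (boxControls Ωm ua ub).Nonempty := by
  refine ⟨Lp.const 2 (arcLength Ωm) ua, ?_⟩
  change ∀ᵐ x ∂(arcLength Ωm), _
  filter_upwards [Lp.coeFn_const (p := 2) (arcLength Ωm) ua] with x hx
  rw [hx]
  exact ⟨le_rfl, h⟩

end InterfaceControl

end

theorem mainTheorem6
    (Ω Ωm : TopologicalSpace.Opens InterfaceControl.Plane)
    (hΩ : InterfaceControl.IsInterfaceGeometry Ω Ωm)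
    (βm βp : ℝ) (hβm : 0 < βm) (hβp : 0 < βp)
    (f yd : InterfaceControl.L2 Ω)
    (α : ℝ) (hα : 0 < α) :
    (∃! T : InterfaceControl.H10 Ω →L[ℝ] InterfaceControl.L2Interface Ωm,
      InterfaceControl.IsTraceOperator T) ∧
    ∀ T : InterfaceControl.H10 Ω →L[ℝ] InterfaceControl.L2Interface Ωm,
      InterfaceControl.IsTraceOperator T →
      (∃! S : InterfaceControl.L2Interface Ωm → InterfaceControl.H10 Ω,
        InterfaceControl.IsSolutionOperator T βm βp f S) ∧
      (∀ U : Set (InterfaceControl.L2Interface Ωm), U.Nonempty → Convex ℝ U → IsClosed U →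
        (∃! p : InterfaceControl.H10 Ω × InterfaceControl.L2Interface Ωm,
          InterfaceControl.IsOptimalPair T βm βp f α yd U p) ∧
        ∀ S : InterfaceControl.L2Interface Ωm → InterfaceControl.H10 Ω,
          InterfaceControl.IsSolutionOperator T βm βp f S →
          ∀ p : InterfaceControl.H10 Ω × InterfaceControl.L2Interface Ωm,
            InterfaceControl.IsReducedSolution S α yd U p ↔
              InterfaceControl.IsOptimalPair T βm βp f α yd U p) ∧
      (∀ ua ub : ℝ, ua < ub →
        (InterfaceControl.boxControls Ωm ua ub).Nonempty ∧
        Convex ℝ (InterfaceControl.boxControls Ωm ua ub) ∧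
        IsClosed (InterfaceControl.boxControls Ωm ua ub)) := by
  have hbound : InterfaceControl.HasTraceBound (InterfaceControl.interface Ωm) :=
    InterfaceControl.hasTraceBound_frontier Ωm.2
      (hΩ.isBounded.subset (subset_closure.trans hΩ.closure_inner_subset)) hΩ.interface_C2
  have := hbound.isFiniteMeasure
  have hB := InterfaceControl.isCoercive_bilinL hΩ.isBounded hΩ.closure_inner_subset
    hbound.volume_eq_zero hβm hβp
  refine ⟨InterfaceControl.existsUnique_traceOperator hbound, fun T _ => ⟨?_, ?_, ?_⟩⟩
  · refine ⟨fun u => hB.continuousLinearEquivOfBilin.symm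
      ((InterfaceControl.H10.valL Ω).adjoint f + T.adjoint u), fun u =>
      (InterfaceControl.isWeakState_iff hΩ.closure_inner_subset hB).2 rfl, fun S hS => ?_⟩
    funext u
    exact (InterfaceControl.isWeakState_iff hΩ.closure_inner_subset hB).1 (hS u)
  · intro U hne hconv hcl
    let E := hB.continuousLinearEquivOfBilin.symm
    let v := InterfaceControl.H10.valL Ω
    have hiff : ∀ S, InterfaceControl.IsSolutionOperator T βm βp f S →
        ∀ u y, InterfaceControl.IsWeakState T βm βp f u y ↔ y = S u := fun S hS u y => by
      have h := (InterfaceControl.isWeakState_iff hΩ.closure_inner_subset hB).1 (hS u)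
      rw [h]
      exact InterfaceControl.isWeakState_iff hΩ.closure_inner_subset hB
    refine ⟨?_, fun S hS p =>
      InterfaceControl.isReducedSolution_iff_isOptimalPair (hiff S hS) α yd U p⟩
    have hS : InterfaceControl.IsSolutionOperator T βm βp f
        fun u => E (v.adjoint f + T.adjoint u) := fun u =>
      (InterfaceControl.isWeakState_iff hΩ.closure_inner_subset hB).2 rfl
    refine (existsUnique_congr fun p =>
      InterfaceControl.isReducedSolution_iff_isOptimalPair (hiff _ hS) α yd U p).1 ?_
    -- `A` is the response of the state to the control alone, and `b` is the state for zero control.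
    refine InterfaceControl.existsUnique_isReducedSolution
      (A := v ∘L E.toContinuousLinearMap ∘L T.adjoint) (b := v (E (v.adjoint f)))
      (fun u => ?_) hα yd hne hconv hcl
    rw [← InterfaceControl.H10.valL_apply, map_add, map_add, add_comm]
    rfl
  · intro ua ub hab
    refine ⟨InterfaceControl.boxControls_nonempty hab.le,
      InterfaceControl.convex_boxControls Ωm ua ub, ?_⟩
    rw [InterfaceControl.boxControls_eq_Icc]
    exact isClosed_Icc
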